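/- Let $n\ge 0$ be an integer, and let $Q_n$ denote the set of all continuous functions on $[-1,1]$ of the form $R=p/q$, where $p$ and $q$ are real polynomials of degree at most $n$ and $q\not\equiv 0$ (at a zero of $q$ in $[-1,1]$ the value of $R$ is understood by continuity). Let $\|R\|=\max_{y\in[-1,1]}|R(y)|$. If $R\in Q_n$ is increasing on $[-1,1]$ (it suffices that $R$ is non-decreasing and not identically zero), then $R$ is differentiable on $(-1,1)$ and $$R'(x)<\frac{9^n}{1-x^2}\,\|R\|\qquad\text{for all } x\in(-1,1).$$ -/

import Mathlib

/-- `R ∈ contRat n` means: on `[-1,1]` the function `R` is continuous and is a rational function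
`p / q` with real polynomials `p`, `q` of degree at most `n`, `q` not the zero polynomial.
The quotient is only evaluated where `q` does not vanish: as `R` is continuous, at a zero of `q`
in `[-1,1]` (a removable singularity) its value is the limit of `p / q`.
Nothing is assumed about `R` outside `[-1,1]`. -/
def contRat (n : ℕ) : Set (ℝ → ℝ) :=
  {R | ContinuousOn R (Set.Icc (-1) 1) ∧
    ∃ p q : Polynomial ℝ, p.natDegree ≤ n ∧ q.natDegree ≤ n ∧ q ≠ 0 ∧
      ∀ x ∈ Set.Icc (-1 : ℝ) 1, q.eval x ≠ 0 → R x = p.eval x / q.eval x}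

/-- The uniform norm on `[-1,1]` (for functions that are continuous there). -/
noncomputable def supNorm (R : ℝ → ℝ) : ℝ :=
  ⨆ x : Set.Icc (-1 : ℝ) 1, |R x|

/-- The derivative of `logCost` with respect to `log s`. -/
noncomputable def costDensity (s : ℝ) : ℝ :=
  if s ≤ 1 / 3 then s / (1 - s) else if s ≤ 3 then 1 / 2 else 1 / (s - 1)

/-- A `C¹` primitive of `costDensity s / s`, vanishing at `0` and bounded by `log (27 / 4)`. -/
noncomputable def logCost (s : ℝ) : ℝ :=
  if s ≤ 1 / 3 then -Real.log (1 - s)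
  else if s ≤ 3 then Real.log (3 / 2) + Real.log (3 * s) / 2
  else Real.log (27 / 4) + Real.log (1 - s⁻¹)

theorem hasDerivAt_ite_le {f g : ℝ → ℝ} {a d : ℝ} (hf : HasDerivAt f d a) (hg : HasDerivAt g d a)
    (h : f a = g a) : HasDerivAt (fun s => if s ≤ a then f s else g s) d a := by
  rw [← hasDerivWithinAt_univ, ← Set.Iic_union_Ici (a := a)]
  refine HasDerivWithinAt.union ?_ ?_
  · refine hf.hasDerivWithinAt.congr (fun x hx => ?_) ?_
    · simp [Set.mem_Iic.1 hx]
    · simp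
  · refine hg.hasDerivWithinAt.congr (fun x hx => ?_) ?_
    · rcases (Set.mem_Ici.1 hx).eq_or_lt with rfl | hx
      · simp [h]
      · simp [not_le.2 hx]
    · simp [h]

theorem costDensity_nonneg {s : ℝ} (hs : 0 ≤ s) : 0 ≤ costDensity s := by
  unfold costDensity
  split_ifs with h1 h2
  · exact div_nonneg hs (by linarith)
  · norm_num
  · exact div_nonneg zero_le_one (by linarith)

theorem hasDerivAt_neg_log_one_sub {s : ℝ} (hs : s < 1) :
    HasDerivAt (fun s : ℝ => -Real.log (1 - s)) (1 / (1 - s)) s := by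
  have h := (((hasDerivAt_id' s).const_sub 1).log (by linarith)).neg
  exact h.congr_deriv (by simp [neg_div])

theorem hasDerivAt_log_three_mul {s : ℝ} (hs : 0 < s) :
    HasDerivAt (fun s : ℝ => Real.log (3 / 2) + Real.log (3 * s) / 2) (1 / 2 / s) s := by
  have h := ((((hasDerivAt_id' s).const_mul 3).log (by linarith)).div_const 2).const_add
    (Real.log (3 / 2))
  exact h.congr_deriv (by field_simp)

theorem hasDerivAt_log_one_sub_inv {s : ℝ} (hs : 1 < s) :
    HasDerivAt (fun s : ℝ => Real.log (27 / 4) + Real.log (1 - s⁻¹)) (1 / (s - 1) / s) s := by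
  have hs' : s⁻¹ < 1 := inv_lt_one_of_one_lt₀ hs
  have h := (((hasDerivAt_inv (by linarith : s ≠ 0)).const_sub 1).log (by linarith)).const_add
    (Real.log (27 / 4))
  refine h.congr_deriv ?_
  have h1 : s - 1 ≠ 0 := by linarith
  have h2 : s ≠ 0 := by linarith
  field_simp

theorem log_three_halves_add : Real.log (3 / 2) + Real.log 9 / 2 + Real.log (3 / 2)
    = Real.log (27 / 4) := by
  have : Real.log 9 = 2 * Real.log 3 := by
    rw [show (9 : ℝ) = 3 ^ 2 by norm_num, Real.log_pow]; norm_num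
  rw [this, show (27 / 4 : ℝ) = 3 / 2 * (3 * (3 / 2)) by norm_num, Real.log_mul (by norm_num)
    (by norm_num), Real.log_mul (by norm_num) (by norm_num)]
  ring

theorem hasDerivAt_logCost {s : ℝ} (hs : 0 < s) :
    HasDerivAt logCost (costDensity s / s) s := by
  have hmid_eq : Real.log (3 / 2) + Real.log (3 * 3) / 2
      = Real.log (27 / 4) + Real.log (1 - (3 : ℝ)⁻¹) := by
    rw [show (1 - (3 : ℝ)⁻¹) = (3 / 2)⁻¹ by norm_num, Real.log_inv, ← log_three_halves_add]
    norm_num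
  rcases lt_trichotomy s (1 / 3) with h | h | h
  · have e : costDensity s / s = 1 / (1 - s) := by
      rw [costDensity, if_pos h.le]
      have : 1 - s ≠ 0 := by linarith
      field_simp
    rw [e]
    refine (hasDerivAt_neg_log_one_sub (by linarith)).congr_of_eventuallyEq ?_
    filter_upwards [Iio_mem_nhds h] with x hx
    simp only [logCost, if_pos (le_of_lt (Set.mem_Iio.1 hx))]
  · subst h
    have e : costDensity (1 / 3) / (1 / 3) = 3 / 2 := by
      rw [costDensity, if_pos le_rfl]; norm_num
    rw [e]
    refine (hasDerivAt_ite_le (f := fun s : ℝ => -Real.log (1 - s))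
      (g := fun s : ℝ => Real.log (3 / 2) + Real.log (3 * s) / 2) ?_ ?_ ?_).congr_of_eventuallyEq ?_
    · convert hasDerivAt_neg_log_one_sub (s := 1 / 3) (by norm_num) using 1; norm_num
    · convert hasDerivAt_log_three_mul (s := 1 / 3) (by norm_num) using 1; norm_num
    · rw [← Real.log_inv]; norm_num
    · filter_upwards [Iio_mem_nhds (show (1 / 3 : ℝ) < 3 by norm_num)] with x hx
      simp only [logCost, if_pos (le_of_lt (Set.mem_Iio.1 hx))]
  rcases lt_trichotomy s 3 with h' | h' | h'
  · have e : costDensity s = 1 / 2 := by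
      rw [costDensity, if_neg (not_le.2 h), if_pos h'.le]
    rw [e]
    refine (hasDerivAt_log_three_mul hs).congr_of_eventuallyEq ?_
    filter_upwards [Iio_mem_nhds h', Ioi_mem_nhds h] with x hx hx'
    simp only [logCost, if_pos (le_of_lt (Set.mem_Iio.1 hx)), if_neg (not_le.2 (Set.mem_Ioi.1 hx'))]
  · subst h'
    have e : costDensity 3 / 3 = 1 / 6 := by
      rw [costDensity, if_neg (by norm_num), if_pos le_rfl]; norm_num
    rw [e]
    refine (hasDerivAt_ite_le (f := fun s : ℝ => Real.log (3 / 2) + Real.log (3 * s) / 2)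
      (g := fun s : ℝ => Real.log (27 / 4) + Real.log (1 - s⁻¹)) ?_ ?_ hmid_eq).congr_of_eventuallyEq
      ?_
    · convert hasDerivAt_log_three_mul (s := 3) (by norm_num) using 1; norm_num
    · convert hasDerivAt_log_one_sub_inv (s := 3) (by norm_num) using 1; norm_num
    · filter_upwards [Ioi_mem_nhds (show (1 / 3 : ℝ) < 3 by norm_num)] with x hx
      simp only [logCost, if_neg (not_le.2 (Set.mem_Ioi.1 hx))]
  · have e : costDensity s = 1 / (s - 1) := by
      rw [costDensity, if_neg (not_le.2 h), if_neg (not_le.2 h')]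
    rw [e]
    refine (hasDerivAt_log_one_sub_inv (by linarith)).congr_of_eventuallyEq ?_
    filter_upwards [Ioi_mem_nhds h', Ioi_mem_nhds h] with x hx hx'
    simp only [logCost, if_neg (not_le.2 (Set.mem_Ioi.1 hx)), if_neg (not_le.2 (Set.mem_Ioi.1 hx'))]

theorem logCost_zero : logCost 0 = 0 := by
  simp [logCost]

theorem continuousAt_logCost {s : ℝ} (hs : 0 ≤ s) : ContinuousAt logCost s := by
  rcases hs.eq_or_lt with rfl | hs
  · refine (hasDerivAt_neg_log_one_sub (s := 0) (by norm_num)).continuousAt.congr ?_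
    filter_upwards [Iio_mem_nhds (show (0 : ℝ) < 1 / 3 by norm_num)] with x hx
    simp only [logCost, if_pos (le_of_lt (Set.mem_Iio.1 hx))]
  · exact (hasDerivAt_logCost hs).continuousAt

theorem logCost_le_of_le_one {s : ℝ} (hs1 : s ≤ 1) :
    2 * logCost s ≤ Real.log (27 / 4) := by
  have hlog : 0 < Real.log 9 := Real.log_pos (by norm_num)
  have h9 : Real.log 9 = 2 * Real.log 3 := by
    rw [show (9 : ℝ) = 3 ^ 2 by norm_num, Real.log_pow]; norm_num
  have key := log_three_halves_add
  unfold logCost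
  split_ifs with h1 h2
  · have : -Real.log (1 - s) ≤ Real.log (3 / 2) := by
      rw [← Real.log_inv]
      refine Real.log_le_log (inv_pos.2 (by linarith)) ?_
      rw [inv_le_comm₀ (by linarith) (by norm_num)]
      norm_num; linarith
    linarith
  · have : Real.log (3 * s) ≤ Real.log 3 := Real.log_le_log (by linarith) (by linarith)
    linarith
  · linarith

theorem logCost_le {s : ℝ} (hs : 0 ≤ s) : logCost s ≤ Real.log (27 / 4) := by
  have hlog : 0 < Real.log (27 / 4) := Real.log_pos (by norm_num)
  have hlog' : 0 < Real.log (3 / 2) := Real.log_pos (by norm_num)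
  have key := log_three_halves_add
  rcases le_total s 1 with h | h
  · linarith [logCost_le_of_le_one h]
  unfold logCost
  rw [if_neg (by linarith)]
  split_ifs with h2
  · have : Real.log (3 * s) ≤ Real.log 9 := Real.log_le_log (by linarith) (by linarith)
    linarith
  · have : Real.log (1 - s⁻¹) ≤ 0 := Real.log_nonpos
      (by linarith [inv_le_one_of_one_le₀ h]) (by linarith [inv_nonneg.2 hs])
    linarith

open Polynomial in
theorem map_conj_roots_map_ofReal (P : ℝ[X]) :
    (P.map (algebraMap ℝ ℂ)).roots.map (starRingEnd ℂ) = (P.map (algebraMap ℝ ℂ)).roots := by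
  rw [← (IsAlgClosed.splits (P.map (algebraMap ℝ ℂ))).roots_map, Polynomial.map_map]
  congr 2
  ext x
  simp

theorem even_card_of_map_conj_eq {S : Multiset ℂ} (hS : S.map (starRingEnd ℂ) = S)
    (him : ∀ z ∈ S, z.im ≠ 0) : Even S.card := by
  have h1 : S.filter (fun z => ¬ 0 < z.im) = (S.filter fun z => 0 < z.im).map (starRingEnd ℂ) := by
    conv_lhs => rw [← hS]
    rw [Multiset.filter_map]
    congr 1
    refine Multiset.filter_congr fun z hz => ?_
    have := him z hz
    simp only [Function.comp, Complex.conj_im, not_lt, Left.neg_nonpos_iff]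
    exact ⟨fun h => lt_of_le_of_ne h this.symm, le_of_lt⟩
  refine ⟨(S.filter fun z => 0 < z.im).card, ?_⟩
  conv_lhs => rw [← Multiset.filter_add_not (fun z : ℂ => 0 < z.im) S]
  rw [Multiset.card_add, h1, Multiset.card_map]

/-- Real roots are charged twice, as the others come in conjugate pairs. -/
noncomputable def rootWeight (z : ℂ) : ℝ := if z.im = 0 then 2 else 1

theorem one_le_rootWeight (z : ℂ) : 1 ≤ rootWeight z := by
  unfold rootWeight; split_ifs <;> norm_num

theorem costDensity_eq_half {s : ℝ} (h : 1 / 3 < s) (h' : s < 3) : costDensity s = 1 / 2 := by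
  rw [costDensity, if_neg (not_le.2 h), if_pos h'.le]

/-- Away from `r = ‖z‖` the logarithmic derivative of `1 - r ^ 2 / z ^ 2` is nearly an integer. -/
theorem abs_re_div_sub_le {z : ℂ} {r : ℝ} (hr : 0 < r) (hz : z ≠ 0)
    (h : r ^ 2 / ‖z‖ ^ 2 ≤ 1 / 3 ∨ 3 ≤ r ^ 2 / ‖z‖ ^ 2) :
    |((r : ℂ) ^ 2 / ((r : ℂ) ^ 2 - z ^ 2)).re - if ‖z‖ < r then 1 else 0|
      ≤ costDensity (r ^ 2 / ‖z‖ ^ 2) := by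
  have hz0 : 0 < ‖z‖ := norm_pos_iff.2 hz
  have hz2 : 0 < ‖z‖ ^ 2 := by positivity
  have hr2 : 0 < r ^ 2 := by positivity
  have n1 : ‖(r : ℂ) ^ 2‖ = r ^ 2 := by simp
  have n2 : ‖z ^ 2‖ = ‖z‖ ^ 2 := by simp
  rcases h with h | h
  · have h3 : r ^ 2 ≤ ‖z‖ ^ 2 / 3 := by rw [div_le_iff₀ hz2] at h; linarith
    have hlt : ¬ ‖z‖ < r := fun hlt => by nlinarith
    rw [if_neg hlt, sub_zero, costDensity, if_pos h]
    refine (Complex.abs_re_le_norm _).trans ?_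
    rw [norm_div, n1]
    have hden : ‖z‖ ^ 2 - r ^ 2 ≤ ‖(r : ℂ) ^ 2 - z ^ 2‖ := by
      have := norm_sub_norm_le (z ^ 2) ((r : ℂ) ^ 2)
      rwa [n1, n2, norm_sub_rev] at this
    have : r ^ 2 / ‖z‖ ^ 2 / (1 - r ^ 2 / ‖z‖ ^ 2) = r ^ 2 / (‖z‖ ^ 2 - r ^ 2) := by
      have : ‖z‖ ^ 2 - r ^ 2 ≠ 0 := by linarith
      field_simp
    rw [this]
    exact div_le_div_of_nonneg_left hr2.le (by linarith) hden
  · have h3 : 3 * ‖z‖ ^ 2 ≤ r ^ 2 := by rw [le_div_iff₀ hz2] at h; linarith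
    have hlt : ‖z‖ < r := by nlinarith
    have hden : r ^ 2 - ‖z‖ ^ 2 ≤ ‖(r : ℂ) ^ 2 - z ^ 2‖ := by
      have := norm_sub_norm_le ((r : ℂ) ^ 2) (z ^ 2)
      rwa [n1, n2] at this
    have hne : (r : ℂ) ^ 2 - z ^ 2 ≠ 0 := norm_pos_iff.1 (by linarith)
    have e : ((r : ℂ) ^ 2 / ((r : ℂ) ^ 2 - z ^ 2)).re - 1
        = (z ^ 2 / ((r : ℂ) ^ 2 - z ^ 2)).re := by
      rw [← Complex.one_re, ← Complex.sub_re]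
      congr 1
      field_simp
      ring
    have hc : costDensity (r ^ 2 / ‖z‖ ^ 2) = ‖z‖ ^ 2 / (r ^ 2 - ‖z‖ ^ 2) := by
      have h1 : r ^ 2 - ‖z‖ ^ 2 ≠ 0 := by linarith
      rcases h.eq_or_lt with h | h
      · rw [← h, costDensity, if_neg (by norm_num), if_pos le_rfl]
        have : r ^ 2 = 3 * ‖z‖ ^ 2 := by rw [eq_div_iff hz2.ne'] at h; linarith
        rw [this]
        field_simp
        ring
      · rw [costDensity, if_neg (by linarith), if_neg (by linarith)]
        have : r ^ 2 / ‖z‖ ^ 2 - 1 = (r ^ 2 - ‖z‖ ^ 2) / ‖z‖ ^ 2 := by field_simp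
        rw [this, one_div_div]
    rw [if_pos hlt, e, hc]
    refine (Complex.abs_re_le_norm _).trans ?_
    rw [norm_div, n2]
    exact div_le_div_of_nonneg_left hz2.le (by linarith) hden

/-- The summand of the cost attached to the root `z`. -/
noncomputable def rootCost (r : ℝ) (z : ℂ) : ℝ := rootWeight z * costDensity (r ^ 2 / ‖z‖ ^ 2)

theorem rootCost_nonneg (r : ℝ) (z : ℂ) : 0 ≤ rootCost r z :=
  mul_nonneg (by linarith [one_le_rootWeight z]) (costDensity_nonneg (by positivity))

theorem rootCost_sum_nonneg (r : ℝ) (S : Multiset ℂ) : 0 ≤ (S.map (rootCost r)).sum :=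
  Multiset.sum_nonneg (by
    intro x hx
    obtain ⟨z, -, rfl⟩ := Multiset.mem_map.1 hx
    exact rootCost_nonneg r z)

/-- If some root has modulus comparable to `r`, the total cost is at least `1`. -/
theorem one_le_sum_rootCost {S : Multiset ℂ} (hS : S.map (starRingEnd ℂ) = S) {r : ℝ} {z : ℂ}
    (hz : z ∈ S) (h : 1 / 3 < r ^ 2 / ‖z‖ ^ 2) (h' : r ^ 2 / ‖z‖ ^ 2 < 3) :
    1 ≤ (S.map (rootCost r)).sum := by
  obtain ⟨T, rfl⟩ := Multiset.exists_cons_of_mem hz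
  rw [Multiset.map_cons, Multiset.sum_cons]
  by_cases him : z.im = 0
  · have : rootCost r z = 1 := by
      rw [rootCost, costDensity_eq_half h h', rootWeight, if_pos him]; norm_num
    linarith [rootCost_sum_nonneg r T]
  · have hc : starRingEnd ℂ z ∈ T := by
      have h1 : starRingEnd ℂ z ∈ z ::ₘ T := by
        rw [← hS]; exact Multiset.mem_map_of_mem _ hz
      rcases Multiset.mem_cons.1 h1 with h1 | h1
      · exact absurd (Complex.conj_eq_iff_im.1 h1) him
      · exact h1
    obtain ⟨U, rfl⟩ := Multiset.exists_cons_of_mem hc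
    rw [Multiset.map_cons, Multiset.sum_cons]
    have e1 : rootCost r z = 1 / 2 := by
      rw [rootCost, costDensity_eq_half h h', rootWeight, if_neg him]; norm_num
    have e2 : rootCost r (starRingEnd ℂ z) = 1 / 2 := by
      rw [rootCost, Complex.norm_conj, costDensity_eq_half h h', rootWeight,
        if_neg (by simpa using him)]; norm_num
    linarith [rootCost_sum_nonneg r U]

theorem abs_sum_sub_le_sum {ι : Type*} (S : Multiset ι) (f k c : ι → ℝ)
    (h : ∀ z ∈ S, |f z - k z| ≤ c z) :
    |(S.map f).sum - (S.map k).sum| ≤ (S.map c).sum := by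
  induction S using Multiset.induction with
  | empty => simp
  | cons a S ih =>
    simp only [Multiset.map_cons, Multiset.sum_cons]
    have h1 := ih fun z hz => h z (Multiset.mem_cons_of_mem hz)
    have h2 := h a (Multiset.mem_cons_self a S)
    rw [abs_le] at *
    constructor <;> linarith [h1.1, h1.2, h2.1, h2.2]

/-- The number of roots in the disc of radius `r` is even if none of them is real. -/
theorem exists_sum_indicator_eq {S : Multiset ℂ} (hS : S.map (starRingEnd ℂ) = S) {r : ℝ}
    (him : ∀ z ∈ S, ‖z‖ < r → z.im ≠ 0) :
    ∃ k : ℤ, (S.map fun z => if ‖z‖ < r then (1 : ℝ) else 0).sum = 2 * k := by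
  have hT : (S.filter fun z => ‖z‖ < r).map (starRingEnd ℂ) = S.filter fun z => ‖z‖ < r := by
    conv_rhs => rw [← hS]
    rw [Multiset.filter_map]
    congr 1
    refine Multiset.filter_congr fun z _ => ?_
    simp
  obtain ⟨k, hk⟩ := even_card_of_map_conj_eq hT fun z hz =>
    him z (Multiset.mem_filter.1 hz).1 (Multiset.mem_filter.1 hz).2
  refine ⟨k, ?_⟩
  have : (S.map fun z => if ‖z‖ < r then (1 : ℝ) else 0).sum
      = ((S.filter fun z => ‖z‖ < r).card : ℝ) := by
    clear hS him hT hk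
    induction S using Multiset.induction with
    | empty => simp
    | cons a S ih =>
      by_cases h : ‖a‖ < r
      · simp [h, ih, add_comm]
      · simp [h, ih]
  rw [this, hk]
  push_cast
  ring

theorem sum_sub_sum_le_sum_rootCost {A B : Multiset ℂ} (hA : A.map (starRingEnd ℂ) = A)
    (hB : B.map (starRingEnd ℂ) = B) {r : ℝ} (hr : 0 < r)
    (hA0 : ∀ z ∈ A, z ≠ 0) (hB0 : ∀ z ∈ B, z ≠ 0)
    (hA1 : ∀ z ∈ A, ‖z‖ < r → z.im ≠ 0) (hB1 : ∀ z ∈ B, ‖z‖ < r → z.im ≠ 0)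
    (h : (B.map fun z : ℂ => ((r : ℂ) ^ 2 / ((r : ℂ) ^ 2 - z ^ 2)).re).sum
      - (A.map fun z : ℂ => ((r : ℂ) ^ 2 / ((r : ℂ) ^ 2 - z ^ 2)).re).sum ≤ 1) :
    (B.map fun z : ℂ => ((r : ℂ) ^ 2 / ((r : ℂ) ^ 2 - z ^ 2)).re).sum
      - (A.map fun z : ℂ => ((r : ℂ) ^ 2 / ((r : ℂ) ^ 2 - z ^ 2)).re).sum
      ≤ (A.map (rootCost r)).sum + (B.map (rootCost r)).sum := by
  have hAn := rootCost_sum_nonneg r A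
  have hBn := rootCost_sum_nonneg r B
  rcases le_or_gt 1 ((A.map (rootCost r)).sum + (B.map (rootCost r)).sum) with h1 | h1
  · linarith
  have far : ∀ S : Multiset ℂ, S.map (starRingEnd ℂ) = S → (S.map (rootCost r)).sum < 1 →
      (∀ z ∈ S, z ≠ 0) →
      |(S.map fun z : ℂ => ((r : ℂ) ^ 2 / ((r : ℂ) ^ 2 - z ^ 2)).re).sum
        - (S.map fun z => if ‖z‖ < r then (1 : ℝ) else 0).sum| ≤ (S.map (rootCost r)).sum := by
    intro S hS hS1 hS0
    refine abs_sum_sub_le_sum S _ _ _ fun z hz => ?_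
    have hfar : r ^ 2 / ‖z‖ ^ 2 ≤ 1 / 3 ∨ 3 ≤ r ^ 2 / ‖z‖ ^ 2 := by
      by_contra! hcon
      linarith [one_le_sum_rootCost hS hz hcon.1 hcon.2]
    refine (abs_re_div_sub_le hr (hS0 z hz) hfar).trans ?_
    exact le_mul_of_one_le_left (costDensity_nonneg (by positivity)) (one_le_rootWeight z)
  have fA := abs_le.1 (far A hA (by linarith) hA0)
  have fB := abs_le.1 (far B hB (by linarith) hB0)
  obtain ⟨a, ha⟩ := exists_sum_indicator_eq hA hA1
  obtain ⟨b, hb⟩ := exists_sum_indicator_eq hB hB1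
  rw [ha] at fA
  rw [hb] at fB
  have hk : (b - a : ℤ) < 1 := by
    have : ((b - a : ℤ) : ℝ) < (1 : ℤ) := by push_cast; linarith [fA.1, fA.2, fB.1, fB.2]
    exact_mod_cast this
  have hk' : ((b - a : ℤ) : ℝ) ≤ (0 : ℤ) := by exact_mod_cast Int.lt_add_one_iff.1 hk
  push_cast at hk'
  linarith [fA.1, fA.2, fB.1, fB.2]

open Polynomial in
theorem sum_logDeriv_eq (P : ℝ[X]) {r : ℝ} (h : P.eval r ≠ 0) (h' : P.eval (-r) ≠ 0) :
    r * (P.derivative.eval r / P.eval r) - r * (P.derivative.eval (-r) / P.eval (-r))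
      = 2 * (((P.map (algebraMap ℝ ℂ)).roots.map
          fun z : ℂ => ((r : ℂ) ^ 2 / ((r : ℂ) ^ 2 - z ^ 2)).re).sum) := by
  set S := (P.map (algebraMap ℝ ℂ)).roots with hS
  have hev : ∀ x : ℝ, (P.map (algebraMap ℝ ℂ)).eval (x : ℂ) = ((P.eval x : ℝ) : ℂ) := fun x => by
    simpa using Polynomial.eval_map_apply (p := P) (algebraMap ℝ ℂ) x
  have hev' : ∀ x : ℝ, (P.map (algebraMap ℝ ℂ)).derivative.eval (x : ℂ)
      = ((P.derivative.eval x : ℝ) : ℂ) := fun x => by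
    rw [Polynomial.derivative_map]
    simpa using Polynomial.eval_map_apply (p := P.derivative) (algebraMap ℝ ℂ) x
  have key : ∀ x : ℝ, P.eval x ≠ 0 → ((P.derivative.eval x / P.eval x : ℝ) : ℂ)
      = (S.map fun z => 1 / ((x : ℂ) - z)).sum := fun x hx => by
    rw [hS, ← (IsAlgClosed.splits _).eval_derivative_div_eval_of_ne_zero, hev, hev']
    · push_cast; rfl
    · rw [hev]; exact_mod_cast hx
  have hne : ∀ x : ℝ, P.eval x ≠ 0 → ∀ z ∈ S, (x : ℂ) - z ≠ 0 := fun x hx z hz h0 => by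
    have h1 : (P.map (algebraMap ℝ ℂ)).eval z = 0 := (Polynomial.mem_roots'.1 hz).2
    rw [← sub_eq_zero.1 h0, hev] at h1
    exact hx (by exact_mod_cast h1)
  have hsum : ((r * (P.derivative.eval r / P.eval r)
      - r * (P.derivative.eval (-r) / P.eval (-r)) : ℝ) : ℂ)
      = (S.map fun z => 2 * ((r : ℂ) ^ 2 / ((r : ℂ) ^ 2 - z ^ 2))).sum := by
    rw [Complex.ofReal_sub, Complex.ofReal_mul, Complex.ofReal_mul, key r h, key (-r) h',
      ← Multiset.sum_map_mul_left, ← Multiset.sum_map_mul_left, ← Multiset.sum_map_sub]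
    refine congrArg Multiset.sum (Multiset.map_congr rfl fun z hz => ?_)
    have h1 := hne r h z hz
    have h2 := hne (-r) h' z hz
    have h3 : (r : ℂ) + z ≠ 0 := fun h0 => h2 (by push_cast; linear_combination -h0)
    have h4 : (r : ℂ) ^ 2 - z ^ 2 ≠ 0 := by
      rw [sq_sub_sq]; exact mul_ne_zero h3 h1
    have h5 : ((-r : ℝ) : ℂ) - z = -((r : ℂ) + z) := by push_cast; ring
    rw [h5, sq_sub_sq, one_div_neg_eq_neg_one_div]
    field_simp
    ring
  rw [← Complex.ofReal_re (_ - _), hsum, Multiset.sum_map_mul_left]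
  have : ∀ f : ℂ → ℂ, ((S.map f).sum).re = (S.map fun z => (f z).re).sum := fun f => by
    have := map_multiset_sum Complex.reAddGroupHom (S.map f)
    simpa [Multiset.map_map] using this
  rw [← this]
  simp

theorem hasDerivAt_multiset_sum {ι : Type*} (S : Multiset ι) {f : ι → ℝ → ℝ} {f' : ι → ℝ} {x : ℝ}
    (h : ∀ z ∈ S, HasDerivAt (f z) (f' z) x) :
    HasDerivAt (fun y => (S.map fun z => f z y).sum) (S.map f').sum x := by
  induction S using Multiset.induction with
  | empty => simpa using hasDerivAt_const x (0 : ℝ)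
  | cons a S ih =>
    simp only [Multiset.map_cons, Multiset.sum_cons]
    exact (h a (Multiset.mem_cons_self a S)).add
      (ih fun z hz => h z (Multiset.mem_cons_of_mem hz))

theorem continuousAt_multiset_sum {ι : Type*} (S : Multiset ι) {f : ι → ℝ → ℝ} {x : ℝ}
    (h : ∀ z ∈ S, ContinuousAt (f z) x) :
    ContinuousAt (fun y => (S.map fun z => f z y).sum) x := by
  induction S using Multiset.induction with
  | empty => simpa using continuousAt_const
  | cons a S ih =>
    simp only [Multiset.map_cons, Multiset.sum_cons]
    exact (h a (Multiset.mem_cons_self a S)).add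
      (ih fun z hz => h z (Multiset.mem_cons_of_mem hz))

/-- The integrated cost of the roots in `S` on the scales from `0` to `r`. -/
noncomputable def totalCost (S : Multiset ℂ) (r : ℝ) : ℝ :=
  (S.map fun z : ℂ => rootWeight z * logCost (r ^ 2 / ‖z‖ ^ 2)).sum

theorem totalCost_zero (S : Multiset ℂ) : totalCost S 0 = 0 := by
  simp [totalCost, logCost_zero]

theorem totalCost_one_le {S : Multiset ℂ} (hS : ∀ z ∈ S, z.im = 0 → 1 ≤ ‖z‖) :
    totalCost S 1 ≤ S.card * Real.log (27 / 4) := by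
  have : totalCost S 1 ≤ (S.map fun _ => Real.log (27 / 4)).sum := by
    refine Multiset.sum_map_le_sum_map _ _ fun z hz => ?_
    unfold rootWeight
    split_ifs with h
    · refine logCost_le_of_le_one ?_
      have h1 := hS z hz h
      rw [one_pow]
      exact (div_le_one (by positivity)).2 (one_le_pow₀ h1)
    · rw [one_mul]
      exact logCost_le (by positivity)
  simpa using this

theorem continuousAt_totalCost (S : Multiset ℂ) (r : ℝ) : ContinuousAt (totalCost S) r := by
  refine continuousAt_multiset_sum S fun z _ => ContinuousAt.mul continuousAt_const ?_
  have h1 : ContinuousAt (fun r : ℝ => r ^ 2 / ‖z‖ ^ 2) r := by fun_prop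
  exact ContinuousAt.comp (f := fun r : ℝ => r ^ 2 / ‖z‖ ^ 2)
    (continuousAt_logCost (by positivity)) h1

theorem hasDerivAt_totalCost {S : Multiset ℂ} (hS : ∀ z ∈ S, z ≠ 0) {r : ℝ} (hr : 0 < r) :
    HasDerivAt (totalCost S) (2 * (S.map (rootCost r)).sum / r) r := by
  have h : HasDerivAt (totalCost S) (S.map fun z => 2 / r * rootCost r z).sum r := by
    refine hasDerivAt_multiset_sum S fun z hz => ?_
    have hz0 : ‖z‖ ≠ 0 := norm_ne_zero_iff.2 (hS z hz)
    have hs : 0 < r ^ 2 / ‖z‖ ^ 2 := by positivity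
    have h1 : HasDerivAt (fun r : ℝ => r ^ 2 / ‖z‖ ^ 2) (2 * r / ‖z‖ ^ 2) r := by
      simpa using (hasDerivAt_pow 2 r).div_const (‖z‖ ^ 2)
    refine (((hasDerivAt_logCost hs).comp r h1).const_mul (rootWeight z)).congr_deriv ?_
    rw [rootCost]
    field_simp
  rw [Multiset.sum_map_mul_left] at h
  exact h.congr_deriv (by ring)

open Polynomial in
theorem log_bound_of_logDeriv {P Q : ℝ[X]} (hP : ∀ x ∈ Set.Icc (-1 : ℝ) 1, P.eval x ≠ 0)
    (hQ : ∀ x ∈ Set.Icc (-1 : ℝ) 1, Q.eval x ≠ 0)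
    (h : ∀ x ∈ Set.Ioo (-1 : ℝ) 1, -1 ≤
      x * (P.derivative.eval x / P.eval x - Q.derivative.eval x / Q.eval x)) :
    2 * Real.log (P.eval 0 / Q.eval 0)
      ≤ Real.log (P.eval 1 / Q.eval 1) + Real.log (P.eval (-1) / Q.eval (-1))
        + (P.natDegree + Q.natDegree) * Real.log (27 / 4) := by
  set A := (P.map (algebraMap ℝ ℂ)).roots with hA
  set B := (Q.map (algebraMap ℝ ℂ)).roots with hB
  have hreal : ∀ F : ℝ[X], (∀ x ∈ Set.Icc (-1 : ℝ) 1, F.eval x ≠ 0) →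
      ∀ z ∈ (F.map (algebraMap ℝ ℂ)).roots, z.im = 0 → 1 < ‖z‖ := by
    intro F hF z hz him
    by_contra! hle
    have hz1 : z = (z.re : ℂ) := Complex.ext (by simp) (by simp [him])
    have h1 : (F.map (algebraMap ℝ ℂ)).eval z = 0 := (Polynomial.mem_roots'.1 hz).2
    have h2 : (F.map (algebraMap ℝ ℂ)).eval (z.re : ℂ) = ((F.eval z.re : ℝ) : ℂ) := by
      simpa using Polynomial.eval_map_apply (p := F) (algebraMap ℝ ℂ) z.re
    rw [hz1, h2] at h1
    refine hF z.re (abs_le.1 ((Complex.abs_re_le_norm z).trans hle)) (by exact_mod_cast h1)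
  have hne : ∀ F : ℝ[X], (∀ x ∈ Set.Icc (-1 : ℝ) 1, F.eval x ≠ 0) →
      ∀ z ∈ (F.map (algebraMap ℝ ℂ)).roots, z ≠ 0 := by
    rintro F hF z hz rfl
    have := hreal F hF 0 hz rfl
    norm_num at this
  have hcard : ∀ F : ℝ[X], ((F.map (algebraMap ℝ ℂ)).roots.card : ℝ) ≤ F.natDegree := fun F => by
    exact_mod_cast Polynomial.card_roots_map_le_natDegree F
  set L : ℝ[X] → ℝ → ℝ := fun F r => Real.log (F.eval r) + Real.log (F.eval (-r)) with hL
  have hLd : ∀ F : ℝ[X], (∀ x ∈ Set.Icc (-1 : ℝ) 1, F.eval x ≠ 0) → ∀ r ∈ Set.Icc (0 : ℝ) 1,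
      HasDerivAt (L F) (F.derivative.eval r / F.eval r
        - F.derivative.eval (-r) / F.eval (-r)) r := by
    intro F hF r hr
    have h1 := (F.hasDerivAt r).log (hF r ⟨by linarith [hr.1], hr.2⟩)
    have h2 : HasDerivAt (fun r : ℝ => F.eval (-r)) (F.derivative.eval (-r) * (-1)) r :=
      (F.hasDerivAt (-r)).comp r (hasDerivAt_neg r)
    have h3 := h2.log (hF (-r) ⟨by linarith [hr.2], by linarith [hr.1]⟩)
    exact (h1.add h3).congr_deriv (by ring)
  have hmono : MonotoneOn (fun r => L P r - L Q r + (totalCost A r + totalCost B r))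
      (Set.Icc 0 1) := by
    refine monotoneOn_of_hasDerivWithinAt_nonneg (f' := fun r =>
      (P.derivative.eval r / P.eval r - P.derivative.eval (-r) / P.eval (-r))
      - (Q.derivative.eval r / Q.eval r - Q.derivative.eval (-r) / Q.eval (-r))
      + (2 * (A.map (rootCost r)).sum / r + 2 * (B.map (rootCost r)).sum / r))
      (convex_Icc 0 1) ?_ ?_ ?_
    · intro r hr
      refine ContinuousAt.continuousWithinAt ?_
      exact ((hLd P hP r hr).continuousAt.sub (hLd Q hQ r hr).continuousAt).add
        ((continuousAt_totalCost A r).add (continuousAt_totalCost B r))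
    · intro r hr
      rw [interior_Icc] at hr
      have hr' := Set.Ioo_subset_Icc_self hr
      exact (((hLd P hP r hr').sub (hLd Q hQ r hr')).add
        ((hasDerivAt_totalCost (hne P hP) hr.1).add
          (hasDerivAt_totalCost (hne Q hQ) hr.1))).hasDerivWithinAt
    · intro r hr
      rw [interior_Icc] at hr
      have hr0 := hr.1
      have mem : r ∈ Set.Icc (-1 : ℝ) 1 := ⟨by linarith [hr.1], hr.2.le⟩
      have mem' : -r ∈ Set.Icc (-1 : ℝ) 1 := ⟨by linarith [hr.2], by linarith [hr.1]⟩
      have eP := sum_logDeriv_eq P (hP r mem) (hP (-r) mem')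
      have eQ := sum_logDeriv_eq Q (hQ r mem) (hQ (-r) mem')
      have h1 := h r ⟨by linarith [hr.1], hr.2⟩
      have h2 := h (-r) ⟨by linarith [hr.2], by linarith [hr.1]⟩
      have key := sum_sub_sum_le_sum_rootCost (map_conj_roots_map_ofReal P)
        (map_conj_roots_map_ofReal Q) hr0 (hne P hP) (hne Q hQ)
        (fun z hz hzr him => by linarith [hreal P hP z hz him, hr.2])
        (fun z hz hzr him => by linarith [hreal Q hQ z hz him, hr.2])
        (by linarith)
      refine nonneg_of_mul_nonneg_right ?_ hr0
      have hexp : r * ((P.derivative.eval r / P.eval r - P.derivative.eval (-r) / P.eval (-r))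
          - (Q.derivative.eval r / Q.eval r - Q.derivative.eval (-r) / Q.eval (-r))
          + (2 * (A.map (rootCost r)).sum / r + 2 * (B.map (rootCost r)).sum / r))
          = (r * (P.derivative.eval r / P.eval r) - r * (P.derivative.eval (-r) / P.eval (-r)))
          - (r * (Q.derivative.eval r / Q.eval r) - r * (Q.derivative.eval (-r) / Q.eval (-r)))
          + (2 * (A.map (rootCost r)).sum + 2 * (B.map (rootCost r)).sum) := by
        rw [← add_div, mul_add, mul_div_cancel₀ _ hr0.ne']
        ring
      rw [hexp, eP, eQ]
      linarith
  have h01 := hmono (Set.left_mem_Icc.2 zero_le_one) (Set.right_mem_Icc.2 zero_le_one) zero_le_one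
  have hlog : 0 ≤ Real.log (27 / 4) := Real.log_nonneg (by norm_num)
  have cA := totalCost_one_le fun z hz hi => (hreal P hP z hz hi).le
  have cB := totalCost_one_le fun z hz hi => (hreal Q hQ z hz hi).le
  have dA := mul_le_mul_of_nonneg_right (hcard P) hlog
  have dB := mul_le_mul_of_nonneg_right (hcard Q) hlog
  simp only [hL, totalCost_zero, neg_zero] at h01
  have m0 : (0 : ℝ) ∈ Set.Icc (-1 : ℝ) 1 := by norm_num
  have m1 : (1 : ℝ) ∈ Set.Icc (-1 : ℝ) 1 := by norm_num
  have m2 : (-1 : ℝ) ∈ Set.Icc (-1 : ℝ) 1 := by norm_num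
  rw [Real.log_div (hP 0 m0) (hQ 0 m0), Real.log_div (hP 1 m1) (hQ 1 m1),
    Real.log_div (hP _ m2) (hQ _ m2)]
  linarith

open Polynomial in
theorem deriv_zero_lt {n : ℕ} {p q : ℝ[X]} (hp : p.natDegree ≤ n) (hq : q.natDegree ≤ n)
    (hq0 : ∀ x ∈ Set.Icc (-1 : ℝ) 1, q.eval x ≠ 0)
    (hmono : MonotoneOn (fun x => p.eval x / q.eval x) (Set.Icc (-1) 1)) {M : ℝ} (hM : 0 < M)
    (hM1 : p.eval 1 / q.eval 1 ≤ M) (hM2 : -M ≤ p.eval (-1) / q.eval (-1)) :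
    deriv (fun x => p.eval x / q.eval x) 0 < 9 ^ n * M := by
  have m0 : (0 : ℝ) ∈ Set.Icc (-1 : ℝ) 1 := by norm_num
  have m1 : (1 : ℝ) ∈ Set.Icc (-1 : ℝ) 1 := by norm_num
  have m2 : (-1 : ℝ) ∈ Set.Icc (-1 : ℝ) 1 := by norm_num
  set c := p.eval 0 / q.eval 0 with hc
  obtain ⟨P, hP⟩ : (X : ℝ[X]) ∣ p - C c * q := by
    rw [Polynomial.X_dvd_iff, Polynomial.coeff_zero_eq_eval_zero]
    simp [hc, div_mul_cancel₀ _ (hq0 0 m0)]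
  have hev : ∀ x, p.eval x = c * q.eval x + x * P.eval x := fun x => by
    have := congrArg (Polynomial.eval x) hP
    simp only [eval_sub, eval_mul, eval_C, eval_X] at this
    linarith
  have hR : ∀ x ∈ Set.Icc (-1 : ℝ) 1, p.eval x / q.eval x = c + x * (P.eval x / q.eval x) := by
    intro x hx
    have := hq0 x hx
    rw [hev]
    field_simp
  have hder : ∀ x ∈ Set.Ioo (-1 : ℝ) 1, HasDerivAt (fun x => p.eval x / q.eval x)
      (P.eval x / q.eval x + x * ((P.derivative.eval x * q.eval x - P.eval x * q.derivative.eval x)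
        / q.eval x ^ 2)) x := by
    intro x hx
    have h1 := (P.hasDerivAt x).div (q.hasDerivAt x) (hq0 x (Set.Ioo_subset_Icc_self hx))
    have h2 := ((hasDerivAt_id' x).mul h1).const_add c
    rw [one_mul] at h2
    refine h2.congr_of_eventuallyEq ?_
    filter_upwards [Icc_mem_nhds hx.1 hx.2] with y hy
    exact hR y hy
  have hder_nonneg : ∀ x ∈ Set.Ioo (-1 : ℝ) 1, 0 ≤ P.eval x / q.eval x +
      x * ((P.derivative.eval x * q.eval x - P.eval x * q.derivative.eval x) / q.eval x ^ 2) := by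
    intro x hx
    have h1 := (hder x hx).hasDerivWithinAt (s := Set.Icc (-1) 1)
    rw [← h1.derivWithin (uniqueDiffOn_Icc (by norm_num) x (Set.Ioo_subset_Icc_self hx))]
    exact hmono.derivWithin_nonneg
  have hd0 := (hder 0 (by norm_num)).deriv
  rw [zero_mul, add_zero] at hd0
  rw [hd0]
  rcases le_or_gt (P.eval 0 / q.eval 0) 0 with hneg | hpos
  · have : 0 < 9 ^ n * M := by positivity
    linarith
  have hPne : P ≠ 0 := by
    rintro rfl
    simp at hpos
  have hdeg : P.natDegree + 1 ≤ n := by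
    have h1 : (p - C c * q).natDegree ≤ n :=
      (natDegree_sub_le _ _).trans (max_le hp ((natDegree_C_mul_le _ _).trans hq))
    rwa [hP, natDegree_X_mul hPne] at h1
  have hfin : ∀ a b : ℝ, a < b → ∃ y ∈ Set.Ioo a b, P.eval y ≠ 0 := by
    intro a b hab
    by_contra! hcon
    exact hPne (eq_zero_of_infinite_isRoot P ((Set.Ioo_infinite hab).mono hcon))
  have hPos : ∀ x ∈ Set.Icc (-1 : ℝ) 1, 0 < P.eval x / q.eval x := by
    intro x hx
    rcases lt_trichotomy x 0 with h | h | h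
    · obtain ⟨y, hy, hy0⟩ := hfin x 0 h
      have hym : y ∈ Set.Icc (-1 : ℝ) 1 := ⟨by linarith [hx.1, hy.1], by linarith [hy.2]⟩
      have hle := hmono hx hym hy.1.le
      have hle' := hmono hym m0 hy.2.le
      simp only [hR x hx, hR y hym, hR 0 m0] at hle hle'
      have hyne : y * (P.eval y / q.eval y) ≠ 0 :=
        mul_ne_zero hy.2.ne (div_ne_zero hy0 (hq0 y hym))
      have : x * (P.eval x / q.eval x) < 0 := by
        refine lt_of_le_of_lt (b := y * (P.eval y / q.eval y)) (by linarith)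
          (lt_of_le_of_ne (by linarith) hyne)
      exact pos_of_mul_neg_right this h.le
    · rwa [h]
    · obtain ⟨y, hy, hy0⟩ := hfin 0 x h
      have hym : y ∈ Set.Icc (-1 : ℝ) 1 := ⟨by linarith [hy.1], by linarith [hx.2, hy.2]⟩
      have hle := hmono hym hx hy.2.le
      have hle' := hmono m0 hym hy.1.le
      simp only [hR x hx, hR y hym, hR 0 m0] at hle hle'
      have hyne : y * (P.eval y / q.eval y) ≠ 0 :=
        mul_ne_zero hy.1.ne' (div_ne_zero hy0 (hq0 y hym))
      have : 0 < x * (P.eval x / q.eval x) := by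
        refine lt_of_lt_of_le (b := y * (P.eval y / q.eval y))
          (lt_of_le_of_ne (by linarith) hyne.symm) (by linarith)
      exact pos_of_mul_pos_right this h.le
  have hP0 : ∀ x ∈ Set.Icc (-1 : ℝ) 1, P.eval x ≠ 0 := fun x hx h0 => by
    have := hPos x hx
    simp [h0] at this
  have key := log_bound_of_logDeriv hP0 hq0 fun x hx => by
    have hxm := Set.Ioo_subset_Icc_self hx
    have h1 := hder_nonneg x hx
    have h2 := hPos x hxm
    have hPx := hP0 x hxm
    have hqx := hq0 x hxm
    have e : P.eval x / q.eval x + x * ((P.derivative.eval x * q.eval x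
        - P.eval x * q.derivative.eval x) / q.eval x ^ 2) = P.eval x / q.eval x *
        (1 + x * (P.derivative.eval x / P.eval x - q.derivative.eval x / q.eval x)) := by
      field_simp
    rw [e] at h1
    linarith [nonneg_of_mul_nonneg_right h1 h2]
  set a := P.eval 1 / q.eval 1 with ha
  set b := P.eval (-1) / q.eval (-1) with hb
  set g := P.eval 0 / q.eval 0 with hg
  have ha0 : 0 < a := hPos 1 m1
  have hb0 : 0 < b := hPos _ m2
  have hab : a + b ≤ 2 * M := by
    rw [hR 1 m1] at hM1
    rw [hR _ m2] at hM2
    linarith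
  have hprod : a * b ≤ M ^ 2 := by nlinarith [sq_nonneg (a - b)]
  have hlogab : Real.log a + Real.log b ≤ 2 * Real.log M := by
    rw [← Real.log_mul ha0.ne' hb0.ne']
    have := Real.log_le_log (mul_pos ha0 hb0) hprod
    rwa [Real.log_pow, Nat.cast_ofNat] at this
  have hl : 0 < Real.log (27 / 4) := Real.log_pos (by norm_num)
  have hl9 : Real.log (27 / 4) < Real.log 9 := Real.log_lt_log (by norm_num) (by norm_num)
  have hdeg' : (P.natDegree : ℝ) + 1 ≤ n := by exact_mod_cast hdeg
  have hq' : (q.natDegree : ℝ) ≤ n := by exact_mod_cast hq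
  have hn : (0 : ℝ) < n := by linarith [(Nat.cast_nonneg P.natDegree : (0 : ℝ) ≤ _)]
  have hlog : Real.log g < Real.log (9 ^ n * M) := by
    rw [Real.log_mul (by positivity) hM.ne', Real.log_pow]
    have h1 : ((P.natDegree : ℝ) + q.natDegree) * Real.log (27 / 4)
        ≤ (2 * n) * Real.log (27 / 4) := mul_le_mul_of_nonneg_right (by linarith) hl.le
    have h2 : (n : ℝ) * Real.log (27 / 4) < n * Real.log 9 := mul_lt_mul_of_pos_left hl9 hn
    linarith
  exact (Real.log_lt_log_iff hpos (by positivity)).1 hlog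

open Polynomial in
/-- `(1 + a y) ^ n * p ((y + a) / (1 + a y))` as a polynomial in `y`. -/
noncomputable def moebiusPullback (n : ℕ) (a : ℝ) (p : ℝ[X]) : ℝ[X] :=
  ∑ i ∈ Finset.range (n + 1), C (p.coeff i) * ((X + C a) ^ i * (C a * X + 1) ^ (n - i))

open Polynomial in
theorem natDegree_moebiusPullback_le (n : ℕ) (a : ℝ) (p : ℝ[X]) :
    (moebiusPullback n a p).natDegree ≤ n := by
  refine natDegree_sum_le_of_forall_le _ _ fun i hi => (natDegree_C_mul_le _ _).trans ?_
  have hi' : i ≤ n := Nat.lt_succ_iff.1 (Finset.mem_range.1 hi)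
  have h1 : (X + C a : ℝ[X]).natDegree ≤ 1 := by compute_degree
  have h2 : (C a * X + 1 : ℝ[X]).natDegree ≤ 1 := by compute_degree
  refine natDegree_mul_le.trans ?_
  have h3 := natDegree_pow_le_of_le i h1
  have h4 := natDegree_pow_le_of_le (n - i) h2
  omega

open Polynomial in
theorem eval_moebiusPullback {n : ℕ} {p : ℝ[X]} (hp : p.natDegree ≤ n) (a : ℝ) {y : ℝ}
    (hy : 1 + a * y ≠ 0) :
    (moebiusPullback n a p).eval y = (1 + a * y) ^ n * p.eval ((y + a) / (1 + a * y)) := by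
  rw [eval_eq_sum_range' (Nat.lt_succ_of_le hp), moebiusPullback, eval_finsetSum, Finset.mul_sum]
  refine Finset.sum_congr rfl fun i hi => ?_
  have hi' : i ≤ n := Nat.lt_succ_iff.1 (Finset.mem_range.1 hi)
  simp only [eval_mul, eval_C, eval_pow, eval_add, eval_X, eval_one]
  rw [← pow_sub_mul_pow (1 + a * y) hi', div_pow, add_comm (a * y) 1]
  have h : (1 + a * y) ^ i ≠ 0 := pow_ne_zero i hy
  rw [mul_assoc _ ((1 + a * y) ^ i), mul_left_comm ((1 + a * y) ^ i), mul_div_cancel₀ _ h]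
  ring

theorem one_add_mul_pos {a y : ℝ} (ha : a ∈ Set.Ioo (-1 : ℝ) 1) (hy : y ∈ Set.Icc (-1 : ℝ) 1) :
    0 < 1 + a * y := by
  have h1 : |a * y| < 1 := by
    rw [abs_mul]
    exact (mul_le_of_le_one_right (abs_nonneg a) (abs_le.2 hy)).trans_lt (abs_lt.2 ha)
  linarith [(abs_lt.1 h1).1]

theorem moebius_mem_Icc {a y : ℝ} (ha : a ∈ Set.Ioo (-1 : ℝ) 1) (hy : y ∈ Set.Icc (-1 : ℝ) 1) :
    (y + a) / (1 + a * y) ∈ Set.Icc (-1 : ℝ) 1 := by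
  have h := one_add_mul_pos ha hy
  rw [Set.mem_Icc, div_le_iff₀ h, le_div_iff₀ h]
  constructor <;> nlinarith [ha.1, ha.2, hy.1, hy.2]

theorem moebius_monotoneOn {a : ℝ} (ha : a ∈ Set.Ioo (-1 : ℝ) 1) :
    MonotoneOn (fun y => (y + a) / (1 + a * y)) (Set.Icc (-1) 1) := by
  intro y hy z hz hyz
  simp only
  rw [div_le_div_iff₀ (one_add_mul_pos ha hy) (one_add_mul_pos ha hz)]
  have : 0 < 1 - a ^ 2 := by nlinarith [ha.1, ha.2]
  nlinarith

open Polynomial in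
theorem deriv_div_lt {n : ℕ} {p q : ℝ[X]} (hp : p.natDegree ≤ n) (hq : q.natDegree ≤ n)
    (hq0 : ∀ x ∈ Set.Icc (-1 : ℝ) 1, q.eval x ≠ 0)
    (hmono : MonotoneOn (fun x => p.eval x / q.eval x) (Set.Icc (-1) 1)) {M : ℝ} (hM : 0 < M)
    (hM1 : p.eval 1 / q.eval 1 ≤ M) (hM2 : -M ≤ p.eval (-1) / q.eval (-1)) {a : ℝ}
    (ha : a ∈ Set.Ioo (-1 : ℝ) 1) :
    deriv (fun x => p.eval x / q.eval x) a < 9 ^ n / (1 - a ^ 2) * M := by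
  have hpull : ∀ y ∈ Set.Icc (-1 : ℝ) 1,
      (moebiusPullback n a p).eval y / (moebiusPullback n a q).eval y
        = p.eval ((y + a) / (1 + a * y)) / q.eval ((y + a) / (1 + a * y)) := by
    intro y hy
    have h := (one_add_mul_pos ha hy).ne'
    rw [eval_moebiusPullback hp a h, eval_moebiusPullback hq a h,
      mul_div_mul_left _ _ (pow_ne_zero n h)]
  have m0 : (0 : ℝ) ∈ Set.Icc (-1 : ℝ) 1 := by norm_num
  have m1 : (1 : ℝ) ∈ Set.Icc (-1 : ℝ) 1 := by norm_num
  have m2 : (-1 : ℝ) ∈ Set.Icc (-1 : ℝ) 1 := by norm_num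
  have e1 : (1 + a) / (1 + a * 1) = 1 := by
    rw [mul_one, div_self]
    linarith [ha.1]
  have e2 : (-1 + a) / (1 + a * -1) = -1 := by
    rw [div_eq_iff (by linarith [ha.2])]
    ring
  have hmain := deriv_zero_lt (natDegree_moebiusPullback_le n a p)
    (natDegree_moebiusPullback_le n a q) (fun y hy => by
      have h := (one_add_mul_pos ha hy).ne'
      rw [eval_moebiusPullback hq a h]
      exact mul_ne_zero (pow_ne_zero n h) (hq0 _ (moebius_mem_Icc ha hy)))
    (fun y hy z hz hyz => by
      simp only [hpull y hy, hpull z hz]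
      exact hmono (moebius_mem_Icc ha hy) (moebius_mem_Icc ha hz)
        (moebius_monotoneOn ha hy hz hyz)) hM
    (by rwa [hpull 1 m1, e1]) (by rwa [hpull _ m2, e2])
  have hF : DifferentiableAt ℝ (fun x => p.eval x / q.eval x) a :=
    (p.differentiable a).fun_div (q.differentiable a) (hq0 a (Set.Ioo_subset_Icc_self ha))
  have hT : HasDerivAt (fun y => (y + a) / (1 + a * y)) (1 - a ^ 2) 0 := by
    have h := ((hasDerivAt_id' (0 : ℝ)).add_const a).div
      (((hasDerivAt_id' (0 : ℝ)).const_mul a).const_add 1) (by norm_num)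
    exact h.congr_deriv (by simp; ring)
  have hcomp : HasDerivAt (fun y => (moebiusPullback n a p).eval y / (moebiusPullback n a q).eval y)
      (deriv (fun x => p.eval x / q.eval x) a * (1 - a ^ 2)) 0 := by
    have hF' : HasDerivAt (fun x => p.eval x / q.eval x) (deriv (fun x => p.eval x / q.eval x) a)
        ((0 + a) / (1 + a * 0)) := by simpa using hF.hasDerivAt
    refine (HasDerivAt.comp (0 : ℝ) hF' hT).congr_of_eventuallyEq ?_
    filter_upwards [Icc_mem_nhds (show (-1 : ℝ) < 0 by norm_num) one_pos] with y hy
    exact hpull y hy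
  rw [hcomp.deriv] at hmain
  have h1 : 0 < 1 - a ^ 2 := by nlinarith [ha.1, ha.2]
  rw [div_mul_eq_mul_div, lt_div_iff₀ h1]
  exact hmain

open Polynomial Filter Topology in
/-- On `[-1, 1]` a continuous rational function has a representation without poles. -/
theorem exists_pole_free_of_mem_contRat {n : ℕ} {R : ℝ → ℝ} (hR : R ∈ contRat n) :
    ∃ p q : ℝ[X], p.natDegree ≤ n ∧ q.natDegree ≤ n ∧
      ∀ x ∈ Set.Icc (-1 : ℝ) 1, q.eval x ≠ 0 ∧ R x = p.eval x / q.eval x := by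
  obtain ⟨hcont, p, q, hp, hq, hq0, h⟩ := hR
  obtain ⟨d, hd⟩ : ∃ d, d = gcd p q := ⟨_, rfl⟩
  obtain ⟨p', hp'⟩ : d ∣ p := hd ▸ gcd_dvd_left p q
  obtain ⟨q', hq'⟩ : d ∣ q := hd ▸ gcd_dvd_right p q
  have hd0 : d ≠ 0 := fun h0 => hq0 (by rw [hq', h0, zero_mul])
  have hcop : IsCoprime p' q' := by
    obtain ⟨u, v, huv⟩ := exists_gcd_eq_mul_add_mul p q
    refine ⟨u, v, mul_left_cancel₀ hd0 ?_⟩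
    rw [← hd] at huv
    linear_combination -huv - u * hp' - v * hq'
  have hdeg : ∀ f g : ℝ[X], f = d * g → f.natDegree ≤ n → g.natDegree ≤ n := by
    rintro f g rfl hf
    rcases eq_or_ne g 0 with rfl | hg
    · simp
    · rw [natDegree_mul hd0 hg] at hf
      omega
  have hmul : ∀ x ∈ Set.Icc (-1 : ℝ) 1, R x * q'.eval x = p'.eval x := by
    intro x hx
    have hc : ContinuousOn (fun x => R x * q'.eval x - p'.eval x) (Set.Icc (-1) 1) :=
      (hcont.mul q'.continuous.continuousOn).sub p'.continuous.continuousOn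
    by_contra hx0
    have hev : ∀ᶠ y in 𝓝[Set.Icc (-1) 1] x, R y * q'.eval y - p'.eval y ≠ 0 :=
      (hc x hx).eventually_ne (sub_ne_zero.2 hx0)
    have hroot : ∀ᶠ y in 𝓝[Set.Icc (-1) 1] x, q.IsRoot y := by
      filter_upwards [hev, self_mem_nhdsWithin] with y hy hym
      by_contra hqy
      refine hy (sub_eq_zero.2 ?_)
      have hqy' : d.eval y * q'.eval y ≠ 0 := by rwa [← eval_mul, ← hq']
      rw [h y hym hqy, hp', hq', eval_mul, eval_mul,
        mul_div_mul_left _ _ (left_ne_zero_of_mul hqy'), div_mul_cancel₀ _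
        (right_ne_zero_of_mul hqy')]
    have hacc : AccPt x (𝓟 (Set.Icc (-1 : ℝ) 1)) :=
      (isPreconnected_Icc.preperfect_of_nontrivial ⟨-1, by norm_num, 1, by norm_num, by norm_num⟩)
        x hx
    have hfreq := accPt_iff_frequently.1 hacc
    have hfin : {y | q.IsRoot y}.Finite := Polynomial.finite_setOfPred_isRoot hq0
    have hcl : ∀ᶠ y in 𝓝 x, y ≠ x → ¬ q.IsRoot y := by
      have : IsClosed ({y | q.IsRoot y} \ {x}) := (hfin.subset Set.sdiff_subset).isClosed
      filter_upwards [this.isOpen_compl.mem_nhds (by simp)] with y hy hyx hr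
      exact hy ⟨hr, hyx⟩
    rw [eventually_nhdsWithin_iff] at hroot
    obtain ⟨y, ⟨hyx, hym⟩, hy1, hy2⟩ := (hfreq.and_eventually (hroot.and hcl)).exists
    exact hy2 hyx (hy1 hym)
  refine ⟨p', q', hdeg p p' hp' hp, hdeg q q' hq' hq, fun x hx => ?_⟩
  have hne : q'.eval x ≠ 0 := by
    intro h0
    have h1 := hmul x hx
    rw [h0, mul_zero] at h1
    obtain ⟨u, v, huv⟩ := hcop
    have := congrArg (Polynomial.eval x) huv
    simp [h0, ← h1] at this
  exact ⟨hne, by rw [eq_div_iff hne, hmul x hx]⟩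

theorem corollary1 (n : ℕ) (R : ℝ → ℝ) (hR : R ∈ contRat n)
    (hmono : MonotoneOn R (Set.Icc (-1) 1))
    (hne : ∃ y ∈ Set.Icc (-1 : ℝ) 1, R y ≠ 0) :
    ∀ x ∈ Set.Ioo (-1 : ℝ) 1,
      DifferentiableAt ℝ R x ∧ deriv R x < (9 : ℝ) ^ n / (1 - x ^ 2) * supNorm R := by
  intro x hx
  have hbdd : ∀ y ∈ Set.Icc (-1 : ℝ) 1, |R y| ≤ supNorm R := by
    obtain ⟨C, hC⟩ := isCompact_Icc.exists_bound_of_continuousOn hR.1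
    intro y hy
    exact le_ciSup (f := fun z : Set.Icc (-1 : ℝ) 1 => |R z|)
      ⟨C, by rintro _ ⟨z, rfl⟩; exact hC z z.2⟩ ⟨y, hy⟩
  have hM : 0 < supNorm R := by
    obtain ⟨y, hy, hy0⟩ := hne
    exact (abs_pos.2 hy0).trans_le (hbdd y hy)
  obtain ⟨p, q, hp, hq, h⟩ := exists_pole_free_of_mem_contRat hR
  have hq0 : ∀ y ∈ Set.Icc (-1 : ℝ) 1, q.eval y ≠ 0 := fun y hy => (h y hy).1
  have m1 : (1 : ℝ) ∈ Set.Icc (-1 : ℝ) 1 := by norm_num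
  have m2 : (-1 : ℝ) ∈ Set.Icc (-1 : ℝ) 1 := by norm_num
  have hEq : R =ᶠ[nhds x] fun y => p.eval y / q.eval y := by
    filter_upwards [Icc_mem_nhds hx.1 hx.2] with y hy
    exact (h y hy).2
  refine ⟨?_, ?_⟩
  · exact ((p.differentiable x).div (q.differentiable x)
      (hq0 x (Set.Ioo_subset_Icc_self hx))).congr_of_eventuallyEq hEq
  · rw [hEq.deriv_eq]
    refine deriv_div_lt hp hq hq0 (hmono.congr fun y hy => (h y hy).2) hM ?_ ?_ hx
    · rw [← (h 1 m1).2]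
      exact (abs_le.1 (hbdd 1 m1)).2
    · rw [← (h _ m2).2]
      exact (abs_le.1 (hbdd _ m2)).1
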